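/- Let $k$ be a field and let $\mathscr{C}$ be a skeletally small, Hom-finite, $k$-linear, Krull--Schmidt additive category (every object is a finite direct sum of objects with local endomorphism rings), equipped with the structure $(\mathscr{C},\mathbb{E},\mathfrak{s})$ of an extriangulated category in the sense of Nakaoka and Palu. An object of $\mathscr{C}$ is called a brick if its endomorphism ring is a division ring. Let $\mathcal{X}$ be a semibrick in $\mathscr{C}$, that is, a set of isomorphism classes of bricks such that $\mathrm{Hom}_{\mathscr{C}}(X_1,X_2)=0$ for any two non-isomorphic objects $X_1,X_2$ in $\mathcal{X}$. Let $\mathrm{Filt}_{\mathscr{C}}(\mathcal{X})$ be the full subcategory of all objects $M$ admitting, for some $n\ge 0$, an $\mathcal{X}$-filtration of length $n$, that is, a chain of inflations $$0=X_0\to X_1\to\cdots\to X_n=M$$ such that the cone of each $X_i\to X_{i+1}$ lies in $\mathcal{X}$. For $M\in\mathrm{Filt}_{\mathscr{C}}(\mathcal{X})$ let $l_{\mathcal{X}}(M)$ denote the minimal length of an $\mathcal{X}$-filtration of $M$. Then: (1) $\mathrm{Filt}_{\mathscr{C}}(\mathcal{X})$ is closed under direct summands in $\mathscr{C}$: if $X\in\mathrm{Filt}_{\mathscr{C}}(\mathcal{X})$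 and $X\cong A\oplus B$ in $\mathscr{C}$, then $A,B\in\mathrm{Filt}_{\mathscr{C}}(\mathcal{X})$. (2) For every $X\in\mathrm{Filt}_{\mathscr{C}}(\mathcal{X})$, if $X\cong A\oplus B$, then $l_{\mathcal{X}}(X)=l_{\mathcal{X}}(A)+l_{\mathcal{X}}(B)$. -/

import Mathlib

open CategoryTheory CategoryTheory.Limits Opposite

universe w v u

namespace Extri

section Sequences

variable {C : Type u} [Category.{v} C]

/-- A sequence of morphisms `A ⟶ B ⟶ D` with fixed end terms `A` and `D`. -/
structure Seq (A D : C) where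
  /-- the middle term -/
  mid : C
  /-- the first morphism -/
  fst : A ⟶ mid
  /-- the second morphism -/
  snd : mid ⟶ D

/-- Two sequences with the same end terms are equivalent if there is an isomorphism of the middle
terms compatible with the identities of the end terms. -/
instance seqSetoid (A D : C) : Setoid (Seq A D) where
  r S T := ∃ b : S.mid ≅ T.mid, S.fst ≫ b.hom = T.fst ∧ b.hom ≫ T.snd = S.snd
  iseqv :=
    { refl := fun S => ⟨Iso.refl _, by simp, by simp⟩
      symm := by
        rintro S T ⟨b, h₁, h₂⟩
        exact ⟨b.symm, by simp [← h₁], by simp [← h₂]⟩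
      trans := by
        rintro S T U ⟨b, h₁, h₂⟩ ⟨c, h₃, h₄⟩
        exact ⟨b ≪≫ c, by simp [reassoc_of% h₁, h₃], by simp [h₄, h₂]⟩ }

/-- Equivalence classes `[A ⟶ B ⟶ D]` of sequences. -/
abbrev SeqClass (A D : C) : Type (max u v) := Quotient (seqSetoid A D)

/-- The equivalence class `[A ⟶ B ⟶ D]` of the sequence given by `x` and `y`. -/
def SeqClass.mk {A B D : C} (x : A ⟶ B) (y : B ⟶ D) : SeqClass A D :=
  Quotient.mk (seqSetoid A D) ⟨B, x, y⟩

variable (E : Cᵒᵖ ⥤ C ⥤ AddCommGrpCat.{w})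

/-- The group `E(D, A)` of `E`-extensions (`D` is the contravariant, `A` the covariant variable). -/
abbrev Ext (D A : C) : Type w := (E.obj (op D)).obj A

variable {E}

/-- `a_* δ = E(D, a)(δ)`. -/
def push {D A A' : C} (a : A ⟶ A') (δ : Ext E D A) : Ext E D A' :=
  ((E.obj (op D)).map a).hom δ

/-- `c^* δ = E(c, A)(δ)`. -/
def pull {D D' A : C} (c : D' ⟶ D) (δ : Ext E D A) : Ext E D' A :=
  ((E.map c.op).app A).hom δ

end Sequences

variable {C : Type u} [Category.{v} C] [Preadditive C] [HasBinaryBiproducts C]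

/-- The direct sum `δ ⊕ δ' ∈ E(D ⊞ D', A ⊞ A')`: the element with components `(δ, 0, 0, δ')` under
`E(D ⊞ D', A ⊞ A') ≅ E(D, A) ⊞ E(D, A') ⊞ E(D', A) ⊞ E(D', A')`. -/
noncomputable def extSum {E : Cᵒᵖ ⥤ C ⥤ AddCommGrpCat.{w}} {D A D' A' : C}
    (δ : Ext E D A) (δ' : Ext E D' A') : Ext E (D ⊞ D') (A ⊞ A') :=
  push biprod.inl (pull biprod.fst δ) + push biprod.inr (pull biprod.snd δ')

end Extri

open Extri in
/-- The structure of an extriangulated category (in the sense of Nakaoka and Palu) on an additive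
category `C`: a biadditive functor `E : Cᵒᵖ × C ⥤ Ab` (ET1), together with an additive
realization `s` of `E` (ET2), subject to (ET3), (ET4) and their duals. -/
structure Extriangulation (C : Type u) [Category.{v} C] [Preadditive C]
    [HasBinaryBiproducts C] where
  /-- the bifunctor of extensions -/
  E : Cᵒᵖ ⥤ C ⥤ AddCommGrpCat.{w}
  /-- (ET1): additivity in the covariant variable -/
  push_additive : ∀ {D A A' : C} (a b : A ⟶ A') (δ : Ext E D A),
    push (a + b) δ = push a δ + push b δ
  /-- (ET1): additivity in the contravariant variable -/
  pull_additive : ∀ {D D' A : C} (c d : D' ⟶ D) (δ : Ext E D A),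
    pull (c + d) δ = pull c δ + pull d δ
  /-- the realization -/
  s : ∀ {D A : C}, Ext E D A → SeqClass A D
  /-- (ET2): `s` is a realization: morphisms of extensions lift to morphisms of sequences. -/
  realization : ∀ {A B D A' B' D' : C} {δ : Ext E D A} {δ' : Ext E D' A'}
    {x : A ⟶ B} {y : B ⟶ D} {x' : A' ⟶ B'} {y' : B' ⟶ D'},
    s δ = SeqClass.mk x y → s δ' = SeqClass.mk x' y' →
    ∀ (a : A ⟶ A') (c : D ⟶ D'), push a δ = pull c δ' →
    ∃ b : B ⟶ B', x ≫ b = a ≫ x' ∧ y ≫ c = b ≫ y'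
  /-- (ET2): the zero extension is realized by the split sequence. -/
  realization_zero : ∀ A D : C,
    s (0 : Ext E D A) = SeqClass.mk (biprod.inl : A ⟶ A ⊞ D) (biprod.snd : A ⊞ D ⟶ D)
  /-- (ET2): `s (δ ⊕ δ') = s δ ⊕ s δ'`. -/
  realization_sum : ∀ {A B D A' B' D' : C} {δ : Ext E D A} {δ' : Ext E D' A'}
    {x : A ⟶ B} {y : B ⟶ D} {x' : A' ⟶ B'} {y' : B' ⟶ D'},
    s δ = SeqClass.mk x y → s δ' = SeqClass.mk x' y' →
    s (extSum δ δ') = SeqClass.mk (biprod.map x x') (biprod.map y y')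
  /-- (ET3) -/
  et3 : ∀ {A B D A' B' D' : C} {δ : Ext E D A} {δ' : Ext E D' A'}
    {x : A ⟶ B} {y : B ⟶ D} {x' : A' ⟶ B'} {y' : B' ⟶ D'},
    s δ = SeqClass.mk x y → s δ' = SeqClass.mk x' y' →
    ∀ (a : A ⟶ A') (b : B ⟶ B'), x ≫ b = a ≫ x' →
    ∃ c : D ⟶ D', push a δ = pull c δ' ∧ y ≫ c = b ≫ y'
  /-- (ET3)ᵒᵖ -/
  et3_op : ∀ {A B D A' B' D' : C} {δ : Ext E D A} {δ' : Ext E D' A'}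
    {x : A ⟶ B} {y : B ⟶ D} {x' : A' ⟶ B'} {y' : B' ⟶ D'},
    s δ = SeqClass.mk x y → s δ' = SeqClass.mk x' y' →
    ∀ (b : B ⟶ B') (c : D ⟶ D'), y ≫ c = b ≫ y' →
    ∃ a : A ⟶ A', push a δ = pull c δ' ∧ x ≫ b = a ≫ x'
  /-- (ET4) -/
  et4 : ∀ {A B D Z F : C} {δ : Ext E D A} {δ' : Ext E F B}
    {f : A ⟶ B} {f' : B ⟶ D} {g : B ⟶ Z} {g' : Z ⟶ F},
    s δ = SeqClass.mk f f' → s δ' = SeqClass.mk g g' →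
    ∃ (G : C) (d : D ⟶ G) (e : G ⟶ F) (h : A ⟶ Z) (h' : Z ⟶ G) (δ'' : Ext E G A),
      h = f ≫ g ∧ f' ≫ d = g ≫ h' ∧ h' ≫ e = g' ∧
      s δ'' = SeqClass.mk h h' ∧
      s (push f' δ') = SeqClass.mk d e ∧
      pull d δ'' = δ ∧
      push f δ'' = pull e δ'
  /-- (ET4)ᵒᵖ -/
  et4_op : ∀ {A B D Z F : C} {δ : Ext E B D} {δ' : Ext E Z F}
    {f' : D ⟶ A} {f : A ⟶ B} {g' : F ⟶ B} {g : B ⟶ Z},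
    s δ = SeqClass.mk f' f → s δ' = SeqClass.mk g' g →
    ∃ (G : C) (d : D ⟶ G) (e : G ⟶ F) (h' : G ⟶ A) (h : A ⟶ Z) (δ'' : Ext E Z G),
      h = f ≫ g ∧ h' ≫ f = e ≫ g' ∧ d ≫ h' = f' ∧
      s δ'' = SeqClass.mk h' h ∧
      s (pull g' δ) = SeqClass.mk d e ∧
      push e δ'' = δ' ∧
      push d δ = pull g δ''

namespace Extri

section KrullSchmidt

variable (C : Type u) [Category.{v} C] [Preadditive C] [HasFiniteBiproducts C]

/-- Every object is a finite direct sum of objects with local endomorphism rings. -/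
def IsKrullSchmidt : Prop :=
  ∀ X : C, ∃ (n : ℕ) (Y : Fin n → C), (∀ i, IsLocalRing (End (Y i))) ∧ Nonempty (X ≅ ⨁ Y)

end KrullSchmidt

section Semibrick

variable {C : Type u} [Category.{v} C] [Preadditive C]

/-- An object is a brick if its endomorphism ring is a division ring. -/
def IsBrick (X : C) : Prop :=
  Nontrivial (End X) ∧ ∀ f : End X, f ≠ 0 → IsUnit f

/-- A semibrick, i.e. a set of isoclasses of pairwise Hom-orthogonal bricks; a set of isoclasses is
encoded as a property of objects that is invariant under isomorphism. -/
structure IsSemibrick (𝒳 : ObjectProperty C) : Prop where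
  closed_iso : 𝒳.IsClosedUnderIsomorphisms
  brick : ∀ X : C, 𝒳 X → IsBrick X
  hom_eq_zero : ∀ X Y : C, 𝒳 X → 𝒳 Y → IsEmpty (X ≅ Y) → ∀ f : X ⟶ Y, f = 0

end Semibrick

section Filtration

variable {C : Type u} [Category.{v} C] [Preadditive C] [HasBinaryBiproducts C]

/-- `A ⟶ B ⟶ D` is a conflation if it realizes some extension. -/
def IsConflation (T : Extriangulation.{w} C) {A B D : C} (x : A ⟶ B) (y : B ⟶ D) : Prop :=
  ∃ δ : Ext T.E D A, T.s δ = SeqClass.mk x y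

/-- `HasFiltration T 𝒳 n M`: there is a chain `0 = X₀ ⟶ X₁ ⟶ ⋯ ⟶ Xₙ = M` of `n` inflations whose
cones all lie in `𝒳`. -/
inductive HasFiltration (T : Extriangulation.{w} C) (𝒳 : ObjectProperty C) : ℕ → C → Prop
  | zero {M : C} (hM : IsZero M) : HasFiltration T 𝒳 0 M
  | succ {n : ℕ} {N M X : C} (hN : HasFiltration T 𝒳 n N) (f : N ⟶ M) (g : M ⟶ X)
      (hfg : IsConflation T f g) (hX : 𝒳 X) : HasFiltration T 𝒳 (n + 1) M

/-- The filtration subcategory generated by `𝒳`. -/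
def Filt (T : Extriangulation.{w} C) (𝒳 : ObjectProperty C) : ObjectProperty C :=
  fun M => ∃ n : ℕ, HasFiltration T 𝒳 n M

/-- The `𝒳`-length of `M`: the minimal length of an `𝒳`-filtration of `M`
(only meaningful for `M` in `Filt T 𝒳`). -/
noncomputable def length (T : Extriangulation.{w} C) (𝒳 : ObjectProperty C) (M : C) : ℕ :=
  sInf {n : ℕ | HasFiltration T 𝒳 n M}

end Filtration

end Extri

namespace Extri

/-! ### Complements of retracts in Krull–Schmidt categories -/

section Complements

/-! Both claims follow from one statement, `HasFiltration.exists_of_retract`: orthogonal retracts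
`A`, `B` of an object with a filtration of length `n` have filtrations of lengths `a`, `b` with `a +
b ≤ n`. The bound `l(X) ≤ l(A) + l(B)` comes from summing filtrations.

Induct on `n`, with last deflation `f : M ⟶ X` and its cocone `N`. If `f` vanishes on `A` and `B`,
both are retracts of `N`. If `f` is nonzero on `A`, replace it by its restriction to `A` extended by
zero on a complement `F`. By `HasFiltration.exists_cocone`, where the semibrick property enters,
this is again a deflation whose cocone `L` has length `n - 1`. By `exists_isConflation_of_isBiprod`,
`L` is `K ⊕ F` with `K ⟶ A ⟶ X` a conflation, so induction applies to `K` and `B` inside `L`.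

Retracts are needed rather than decompositions: `f` may be zero, and then `A ⊕ B` is only a summand
of `N`. -/

lemma isIso_of_comp_isIso {C : Type u} [Category.{v} C] {X Y : C} (f : X ⟶ Y) (g : Y ⟶ X)
    (h₁ : IsIso (f ≫ g))
    (h₂ : IsIso (g ≫ f)) : IsIso f := by
  have : IsSplitMono f := ⟨⟨⟨g ≫ inv (f ≫ g), by rw [← Category.assoc, IsIso.hom_inv_id]⟩⟩⟩
  have : Epi f := by
    have : Epi (g ≫ f) := inferInstance
    exact epi_of_epi g f
  exact isIso_of_epi_of_isSplitMono f

variable {C : Type u} [Category.{v} C] [Preadditive C]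

/-- The morphisms exhibit `B` as a biproduct of `A` and `D`. -/
structure IsBiprod {A B D : C} (i : A ⟶ B) (p : B ⟶ A) (j : D ⟶ B) (q : B ⟶ D) : Prop where
  inl_fst : i ≫ p = 𝟙 A
  inr_snd : j ≫ q = 𝟙 D
  total : p ≫ i + q ≫ j = 𝟙 B

namespace IsBiprod

variable {A B D : C} {i : A ⟶ B} {p : B ⟶ A} {j : D ⟶ B} {q : B ⟶ D}

lemma symm (h : IsBiprod i p j q) : IsBiprod j q i p :=
  ⟨h.inr_snd, h.inl_fst, by rw [add_comm, h.total]⟩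

lemma inl_snd (h : IsBiprod i p j q) : i ≫ q = 0 := by
  have h₁ : i ≫ (p ≫ i + q ≫ j) ≫ q = i ≫ q := by rw [h.total, Category.id_comp]
  simp only [Preadditive.add_comp, Preadditive.comp_add, Category.assoc, h.inr_snd,
    Category.comp_id, reassoc_of% h.inl_fst] at h₁
  simpa using h₁

lemma inr_fst (h : IsBiprod i p j q) : j ≫ p = 0 := h.symm.inl_snd

end IsBiprod

lemma isBiprod_id_left (A : C) {Z : C} (hZ : IsZero Z) :
    IsBiprod (𝟙 A) (𝟙 A) (0 : Z ⟶ A) (0 : A ⟶ Z) :=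
  ⟨by simp, hZ.eq_of_src _ _, by simp⟩

lemma isIso_of_sub_one_sq {X : C} (t : X ⟶ X) (h : (t - 𝟙 X) ≫ (t - 𝟙 X) = 0) : IsIso t := by
  have h' : t ≫ t = t + t - 𝟙 X := by
    simp only [Preadditive.sub_comp, Preadditive.comp_sub, Category.id_comp,
      Category.comp_id] at h
    rw [← sub_eq_zero, ← h]; abel
  refine ⟨𝟙 X + 𝟙 X - t, ?_, ?_⟩
  · simp [Preadditive.comp_sub, Preadditive.comp_add, h']
  · simp [Preadditive.sub_comp, Preadditive.add_comp, h']

lemma exists_isUnit_of_isUnit_sum {R ι : Type*} [Ring R] [IsLocalRing R] (s : Finset ι)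
    (f : ι → R) (h : IsUnit (∑ i ∈ s, f i)) : ∃ i ∈ s, IsUnit (f i) := by
  classical
  induction s using Finset.induction_on with
  | empty => simp at h
  | insert a s ha ih =>
    rw [Finset.sum_insert ha] at h
    obtain ⟨u, hu⟩ := h
    have h₁ : (↑u⁻¹ * f a) + (↑u⁻¹ * ∑ i ∈ s, f i) = 1 := by
      rw [← mul_add, ← hu, Units.inv_mul]
    rcases IsLocalRing.isUnit_or_isUnit_of_add_one h₁ with h₂ | h₂
    · exact ⟨a, Finset.mem_insert_self _ _, by simpa using h₂⟩
    · obtain ⟨i, hi, hi'⟩ := ih (by simpa using h₂)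
      exact ⟨i, Finset.mem_insert_of_mem hi, hi'⟩

lemma eq_one_of_idempotent_of_ne_zero {R : Type*} [Ring R] [IsLocalRing R] {e : R}
    (h : e * e = e) (h0 : e ≠ 0) : e = 1 := by
  rcases IsLocalRing.isUnit_or_isUnit_of_add_one (a := e) (b := 1 - e) (by simp) with h₁ | h₁
  · exact h₁.mul_left_cancel (by rw [h, mul_one])
  · exact absurd (h₁.mul_left_cancel (b := e) (c := 0) (by
      rw [sub_mul, h, one_mul, sub_self, mul_zero])) h0

variable [HasFiniteBiproducts C]

/-- Exchange argument: the identity of `Y` is a sum of maps through the summands of `K`, so one of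
them is a unit, `Y` is isomorphic to that summand, and the remaining summands form a complement. -/
lemma exists_complement_of_isLocalRing (hC : IsKrullSchmidt C) {Y K : C} [IsLocalRing (End Y)]
    (a : Y ⟶ K) (b : K ⟶ Y) (hab : a ≫ b = 𝟙 Y) :
    ∃ (K' : C) (i : K' ⟶ K) (p : K ⟶ K'), IsBiprod a b i p := by
  classical
  obtain ⟨n, Z, hZ, ⟨e⟩⟩ := hC K
  let ι : ∀ l, Z l ⟶ K := fun l => biproduct.ι Z l ≫ e.inv
  let π : ∀ l, K ⟶ Z l := fun l => e.hom ≫ biproduct.π Z l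
  have htot : ∑ l, π l ≫ ι l = 𝟙 K := by
    have : e.hom ≫ (∑ l, biproduct.π Z l ≫ biproduct.ι Z l) ≫ e.inv = 𝟙 K := by
      rw [biproduct.total]; simp
    simpa only [ι, π, Preadditive.sum_comp, Preadditive.comp_sum, Category.assoc] using this
  have hunit : IsUnit (∑ l, (show End Y from (a ≫ π l) ≫ (ι l ≫ b))) := by
    have : (∑ l, (show End Y from (a ≫ π l) ≫ (ι l ≫ b))) = (1 : End Y) := by
      change (∑ l, (a ≫ π l) ≫ (ι l ≫ b)) = 𝟙 Y
      rw [← hab]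
      have := congrArg (fun t => a ≫ t ≫ b) htot
      simpa [Preadditive.sum_comp, Preadditive.comp_sum] using this
    rw [this]; exact isUnit_one
  obtain ⟨l, -, hl⟩ := exists_isUnit_of_isUnit_sum _ _ hunit
  let c : Y ⟶ Z l := a ≫ π l
  let d : Z l ⟶ Y := ι l ≫ b
  have hcd : IsIso (c ≫ d) := (isUnit_iff_isIso _).1 hl
  have hdc : d ≫ inv (c ≫ d) ≫ c = 𝟙 (Z l) := by
    have := hZ l
    refine eq_one_of_idempotent_of_ne_zero (R := End (Z l)) (e := d ≫ inv (c ≫ d) ≫ c) ?_ ?_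
    · change (d ≫ inv (c ≫ d) ≫ c) ≫ (d ≫ inv (c ≫ d) ≫ c) = d ≫ inv (c ≫ d) ≫ c
      have : c ≫ d ≫ inv (c ≫ d) = 𝟙 _ := by rw [← Category.assoc, IsIso.hom_inv_id]
      simp only [Category.assoc, reassoc_of% this]
    · intro h0
      have h1 : c ≫ (d ≫ inv (c ≫ d) ≫ c) ≫ d = 0 := by
        have h0' : d ≫ inv (c ≫ d) ≫ c = 0 := h0
        rw [h0', zero_comp, comp_zero]
      have h2 : c ≫ d = 0 := by
        simpa only [Category.assoc, IsIso.inv_hom_id, Category.comp_id] using h1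
      have h3 : 𝟙 Y = 0 := by
        rw [← IsIso.hom_inv_id (c ≫ d)]
        nth_rewrite 1 [h2]
        rw [zero_comp]
      exact one_ne_zero (α := End Y) h3
  let d' : Y ⟶ Z l := inv (c ≫ d) ≫ c
  have hd'd : d' ≫ d = 𝟙 Y := by simp [d']
  have hdd' : d ≫ d' = 𝟙 _ := hdc
  let j : (⨁ Subtype.restrict (fun m => m ≠ l) Z) ⟶ K :=
    biproduct.fromSubtype Z (fun m => m ≠ l) ≫ e.inv
  let q : K ⟶ (⨁ Subtype.restrict (fun m => m ≠ l) Z) :=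
    e.hom ≫ biproduct.toSubtype Z (fun m => m ≠ l)
  have hjq : j ≫ q = 𝟙 _ := by simp [j, q]
  have hιq : ι l ≫ q = 0 := by simp [ι, q, biproduct.ι_toSubtype]
  have hqj : q ≫ j = 𝟙 K - π l ≫ ι l := by
    have h1 : biproduct.toSubtype Z (fun m => m ≠ l) ≫ biproduct.fromSubtype Z (fun m => m ≠ l)
        = 𝟙 _ - biproduct.π Z l ≫ biproduct.ι Z l := by
      rw [biproduct.toSubtype_fromSubtype]
      refine biproduct.hom_ext' _ _ fun m => biproduct.hom_ext _ _ fun m' => ?_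
      by_cases hm : m = l
      · subst hm
        simp
      · simp [hm, biproduct.ι_π_ne_assoc Z hm]
    have := congrArg (fun t => e.hom ≫ t ≫ e.inv) h1
    simpa [j, q, ι, π, Preadditive.sub_comp, Preadditive.comp_sub] using this
  have hd : ι l ≫ b = d := rfl
  -- The inclusion `j` is corrected along the summand `Z l` so that it lands in the kernel of `b`.
  refine ⟨_, j ≫ (𝟙 K - b ≫ d' ≫ ι l), (𝟙 K - b ≫ a) ≫ q, hab, ?_, ?_⟩
  · have h0 : (𝟙 K - b ≫ d' ≫ ι l) ≫ b = 0 := by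
      simp [Preadditive.sub_comp, hd, hd'd]
    have h1 : (𝟙 K - b ≫ d' ≫ ι l) ≫ (𝟙 K - b ≫ a) = 𝟙 K - b ≫ d' ≫ ι l := by
      rw [Preadditive.comp_sub, reassoc_of% h0]; simp
    rw [Category.assoc, reassoc_of% h1]
    simp [Preadditive.sub_comp, hjq, hιq]
  · have h1 : q ≫ j ≫ (𝟙 K - b ≫ d' ≫ ι l) = 𝟙 K - b ≫ d' ≫ ι l := by
      rw [← Category.assoc, hqj]
      simp [Preadditive.sub_comp, Preadditive.comp_sub, reassoc_of% hd, reassoc_of% hdd']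
    rw [Category.assoc, h1]
    simp [Preadditive.sub_comp, Preadditive.comp_sub, reassoc_of% hab]

/-- In a Krull-Schmidt category every retract has a complement. -/
lemma exists_complement (hC : IsKrullSchmidt C) {B N : C} (s : B ⟶ N) (r : N ⟶ B)
    (hsr : s ≫ r = 𝟙 B) :
    ∃ (K : C) (i : K ⟶ N) (p : N ⟶ K), IsBiprod s r i p := by
  classical
  obtain ⟨n, Y, hY, ⟨e⟩⟩ := hC B
  let ι : ∀ l, Y l ⟶ N := fun l => biproduct.ι Y l ≫ e.inv ≫ s
  let π : ∀ l, N ⟶ Y l := fun l => r ≫ e.hom ≫ biproduct.π Y l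
  have hιπ : ∀ l, ι l ≫ π l = 𝟙 _ := fun l => by simp [ι, π, reassoc_of% hsr]
  have hιπ' : ∀ l m, l ≠ m → ι l ≫ π m = 0 := fun l m h => by
    simp [ι, π, reassoc_of% hsr, biproduct.ι_π_ne Y h]
  -- Split off the indecomposable summands of `B` one at a time.
  have key : ∀ S : Finset (Fin n), ∃ (K : C) (i : K ⟶ N) (p : N ⟶ K),
      i ≫ p = 𝟙 K ∧ p ≫ i + ∑ l ∈ S, π l ≫ ι l = 𝟙 N := by
    intro S
    induction S using Finset.induction_on with
    | empty => exact ⟨N, 𝟙 N, 𝟙 N, by simp, by simp⟩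
    | insert m S hm ih =>
      obtain ⟨K, i, p, hip, hpi⟩ := ih
      have hpi' : p ≫ i = 𝟙 N - ∑ l ∈ S, π l ≫ ι l := by rw [← hpi]; abel
      have h₁ : p ≫ i ≫ π m = π m := by
        rw [← Category.assoc, hpi', Preadditive.sub_comp, Preadditive.sum_comp,
          Finset.sum_eq_zero, sub_zero, Category.id_comp]
        intro l hl
        rw [Category.assoc, hιπ' l m (fun h => hm (h ▸ hl)), comp_zero]
      have h₂ : ι m ≫ p ≫ i = ι m := by
        rw [hpi', Preadditive.comp_sub, Preadditive.comp_sum,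
          Finset.sum_eq_zero, sub_zero, Category.comp_id]
        intro l hl
        rw [← Category.assoc, hιπ' m l (fun h => hm (h ▸ hl)), zero_comp]
      have := hY m
      obtain ⟨K', i', p', h⟩ := exists_complement_of_isLocalRing hC (ι m ≫ p) (i ≫ π m)
        (by rw [Category.assoc, h₁, hιπ])
      refine ⟨K', i' ≫ i, p ≫ p', ?_, ?_⟩
      · rw [Category.assoc, reassoc_of% hip, h.inr_snd]
      · have h₃ : p' ≫ i' = 𝟙 K - (i ≫ π m) ≫ ι m ≫ p := by rw [← h.total]; abel
        rw [Finset.sum_insert hm, ← hpi, Category.assoc, reassoc_of% h₃]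
        simp only [Preadditive.sub_comp, Preadditive.comp_sub, Category.assoc, h₂,
          reassoc_of% h₁, Category.id_comp]
        abel
  obtain ⟨K, i, p, hip, hpi⟩ := key Finset.univ
  refine ⟨K, i, p, hsr, hip, ?_⟩
  rw [← hpi, add_comm]
  congr 1
  have : r ≫ e.hom ≫ (∑ l, biproduct.π Y l ≫ biproduct.ι Y l) ≫ e.inv ≫ s = r ≫ s := by
    rw [biproduct.total]; simp
  simpa only [ι, π, Preadditive.sum_comp, Preadditive.comp_sum, Category.assoc] using this.symm

end Complements

section Bifunctor

variable {C : Type u} [Category.{v} C] {E : Cᵒᵖ ⥤ C ⥤ AddCommGrpCat.{w}}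

lemma push_id {D A : C} (δ : Ext E D A) : push (𝟙 A) δ = δ := by simp [push]

lemma push_comp {D A A' A'' : C} (a : A ⟶ A') (a' : A' ⟶ A'') (δ : Ext E D A) :
    push (a ≫ a') δ = push a' (push a δ) := by simp [push]

lemma push_ext_zero {D A A' : C} (a : A ⟶ A') : push a (0 : Ext E D A) = 0 := by simp [push]

lemma pull_id {D A : C} (δ : Ext E D A) : pull (𝟙 D) δ = δ := by simp [pull]

lemma pull_comp {D D' D'' A : C} (c : D' ⟶ D) (c' : D'' ⟶ D') (δ : Ext E D A) :
    pull (c' ≫ c) δ = pull c' (pull c δ) := by simp [pull]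

lemma pull_ext_zero {D D' A : C} (c : D' ⟶ D) : pull c (0 : Ext E D A) = 0 := by simp [pull]

lemma SeqClass.mk_eq_of_iso {A B B' D : C} {x : A ⟶ B} {y : B ⟶ D} {x' : A ⟶ B'} {y' : B' ⟶ D}
    (b : B ≅ B') (h₁ : x ≫ b.hom = x') (h₂ : b.hom ≫ y' = y) :
    SeqClass.mk x y = SeqClass.mk x' y' := Quotient.sound ⟨b, h₁, h₂⟩

end Bifunctor

/-! ### Exactness and splitting of conflations -/

section Conflations

variable {C : Type u} [Category.{v} C] [Preadditive C] [HasBinaryBiproducts C]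

variable (T : Extriangulation.{w} C)

lemma exists_seqClass_eq {D A : C} (δ : Ext T.E D A) :
    ∃ (B : C) (x : A ⟶ B) (y : B ⟶ D), T.s δ = SeqClass.mk x y := by
  obtain ⟨S, hS⟩ := Quotient.exists_rep (T.s δ)
  exact ⟨S.mid, S.fst, S.snd, hS.symm⟩

lemma IsBiprod.seqClass_zero {A B D : C} {i : A ⟶ B} {p : B ⟶ A} {j : D ⟶ B} {q : B ⟶ D}
    (h : IsBiprod i p j q) : T.s (0 : Ext T.E D A) = SeqClass.mk i q := by
  rw [T.realization_zero]
  refine SeqClass.mk_eq_of_iso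
    ⟨biprod.desc i j, biprod.lift p q, ?_, ?_⟩ (by simp) ?_
  · ext <;> simp [h.inl_fst, h.inr_snd, h.inl_snd, h.inr_fst]
  · simp [biprod.lift_desc, h.total]
  · ext <;> simp [h.inr_snd, h.inl_snd]

variable {T}

lemma isConflation_comp_iso_mid {A B B' D : C} {x : A ⟶ B} {y : B ⟶ D} (h : IsConflation T x y)
    (b : B ≅ B') : IsConflation T (x ≫ b.hom) (b.inv ≫ y) := by
  obtain ⟨δ, hδ⟩ := h
  exact ⟨δ, hδ.trans (SeqClass.mk_eq_of_iso b rfl (by simp))⟩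

section Exactness

variable [HasZeroObject C]

open ZeroObject

variable {A B D : C} {δ : Ext T.E D A} {x : A ⟶ B} {y : B ⟶ D}

/-- Exactness here and below comes from comparing, via (ET3) or its dual, with the split conflations
`A ⟶ A ⟶ 0` and `0 ⟶ W ⟶ W`. -/
lemma comp_eq_zero_of_seqClass (h : T.s δ = SeqClass.mk x y) : x ≫ y = 0 := by
  obtain ⟨c, -, hc⟩ := T.et3 ((isBiprod_id_left A (isZero_zero C)).seqClass_zero T) h (𝟙 A) x
    (by simp)
  simpa using hc.symm

lemma exists_lift_of_seqClass (h : T.s δ = SeqClass.mk x y) {W : C} (t : W ⟶ B)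
    (ht : t ≫ y = 0) : ∃ a : W ⟶ A, a ≫ x = t := by
  obtain ⟨a, -, ha⟩ := T.et3_op ((isBiprod_id_left W (isZero_zero C)).seqClass_zero T) h t 0
    (by simp [ht])
  exact ⟨a, by simpa using ha.symm⟩

lemma exists_desc_of_seqClass (h : T.s δ = SeqClass.mk x y) {W : C} (t : B ⟶ W)
    (ht : x ≫ t = 0) : ∃ c : D ⟶ W, y ≫ c = t := by
  obtain ⟨c, -, hc⟩ := T.et3 h ((isBiprod_id_left W (isZero_zero C)).symm.seqClass_zero T) 0 t
    (by simp [ht])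
  exact ⟨c, by simpa using hc⟩

lemma push_eq_zero_of_seqClass (h : T.s δ = SeqClass.mk x y) : push x δ = 0 := by
  obtain ⟨c, hc, -⟩ := T.et3 h ((isBiprod_id_left B (isZero_zero C)).seqClass_zero T) x (𝟙 B)
    (by simp)
  rw [hc, pull_ext_zero]

/-- `t - 𝟙` factors through `y` and is killed by `y`, hence squares to zero. This replaces the five
lemma. -/
lemma isIso_of_seqClass_endo (h : T.s δ = SeqClass.mk x y) (t : B ⟶ B) (h₁ : x ≫ t = x)
    (h₂ : t ≫ y = y) : IsIso t := by
  obtain ⟨u, hu⟩ := exists_desc_of_seqClass h (t - 𝟙 B) (by simp [Preadditive.comp_sub, h₁])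
  refine isIso_of_sub_one_sq t ?_
  nth_rewrite 2 [← hu]
  rw [← Category.assoc, Preadditive.sub_comp, h₂]
  simp

lemma isConflation_comp_iso_right (h : IsConflation T x y) {D' : C} (c : D ≅ D') :
    IsConflation T x (y ≫ c.hom) := by
  obtain ⟨δ, hδ⟩ := h
  obtain ⟨B', x', y', hδ'⟩ := exists_seqClass_eq T (pull c.inv δ)
  have hc : pull c.hom (pull c.inv δ) = δ := by rw [← pull_comp, c.hom_inv_id, pull_id]
  obtain ⟨b, hb₁, hb₂⟩ := T.realization hδ hδ' (𝟙 A) c.hom (by rw [push_id, hc])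
  obtain ⟨b', hb₁', hb₂'⟩ := T.realization hδ' hδ (𝟙 A) c.inv (by rw [push_id])
  rw [Category.id_comp] at hb₁ hb₁'
  have : IsIso b := by
    refine isIso_of_comp_isIso b b' ?_ ?_
    · refine isIso_of_seqClass_endo hδ _ (by rw [reassoc_of% hb₁, hb₁']) ?_
      rw [Category.assoc, ← hb₂', ← reassoc_of% hb₂, c.hom_inv_id, Category.comp_id]
    · refine isIso_of_seqClass_endo hδ' _ (by rw [reassoc_of% hb₁', hb₁]) ?_
      rw [Category.assoc, ← hb₂, ← reassoc_of% hb₂', c.inv_hom_id, Category.comp_id]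
  exact ⟨_, hδ'.trans (SeqClass.mk_eq_of_iso (asIso b) hb₁ hb₂.symm).symm⟩

/-- A split inflation is the inclusion of a direct summand whose complement is the cone. -/
lemma exists_section_of_retraction (h : T.s δ = SeqClass.mk x y) (t : B ⟶ A)
    (ht : x ≫ t = 𝟙 A) : ∃ u : D ⟶ B, IsBiprod x t u y := by
  have hδ : δ = 0 := by
    rw [← push_id δ, ← ht, push_comp, push_eq_zero_of_seqClass h, push_ext_zero]
  rw [hδ, T.realization_zero] at h
  obtain ⟨b, hb₁, hb₂⟩ := Quotient.exact h
  change A ⊞ D ≅ B at b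
  change biprod.inl ≫ b.hom = x at hb₁
  change b.hom ≫ y = biprod.snd at hb₂
  have hy : y = b.inv ≫ biprod.snd := by rw [← hb₂, b.inv_hom_id_assoc]
  have htot : (b.inv ≫ biprod.fst) ≫ x + y ≫ biprod.inr ≫ b.hom = 𝟙 B := by
    have : b.inv ≫ (biprod.fst ≫ biprod.inl + biprod.snd ≫ biprod.inr) ≫ b.hom = 𝟙 B := by
      rw [biprod.total]; simp
    simpa only [Preadditive.add_comp, Preadditive.comp_add, Category.assoc, hb₁, hy] using this
  have hxy : x ≫ y = 0 := by simp [← hb₁, hb₂]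
  have hyu : y ≫ biprod.inr ≫ b.hom = 𝟙 B - (b.inv ≫ biprod.fst) ≫ x := by
    rw [← htot]; abel
  -- An arbitrary section of `y`, corrected so that `t` kills it.
  refine ⟨(biprod.inr ≫ b.hom) ≫ (𝟙 B - t ≫ x), ht, ?_, ?_⟩
  · simp [Preadditive.sub_comp, Preadditive.comp_sub, hxy, hb₂]
  · rw [← Category.assoc y, hyu]
    simp [Preadditive.sub_comp, Preadditive.comp_sub, reassoc_of% ht]

/-- If a deflation vanishes on a direct summand `F` of its source `B = A ⊕ F`, then its
restriction to `A` is a deflation, and `F` splits off from the cocone. -/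
lemma exists_isConflation_of_isBiprod {N M X A F K : C} {δ : Ext T.E X N} {j : N ⟶ M}
    {iA : A ⟶ M} {pA : M ⟶ A} {iF : F ⟶ M} {pF : M ⟶ F} (hM : IsBiprod iA pA iF pF)
    {g : A ⟶ X} (h : T.s δ = SeqClass.mk j (pA ≫ g)) {f : F ⟶ N} (hf : f ≫ j = iF)
    {k : K ⟶ N} {p : N ⟶ K} (hN : IsBiprod f (j ≫ pF) k p) :
    IsConflation T (k ≫ j ≫ pA) g := by
  obtain ⟨L, x, y, hL⟩ := exists_seqClass_eq T (push p δ)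
  -- The `F`-component of `δ` factors through `push j δ`, which is zero.
  have hpk : push k (push p δ) = δ := by
    have h₁ : push (p ≫ k) δ = push (𝟙 N) δ := by
      rw [← hN.total, T.push_additive, push_comp, push_comp, push_comp, push_eq_zero_of_seqClass h]
      simp [push_ext_zero]
    rw [← push_comp, h₁, push_id]
  obtain ⟨b, hb₁, hb₂⟩ := T.realization h hL p (𝟙 X) (by rw [pull_id])
  obtain ⟨b', hb₁', hb₂'⟩ := T.realization hL h k (𝟙 X) (by rw [hpk, pull_id])
  rw [Category.comp_id] at hb₂ hb₂'
  have hkF : k ≫ j ≫ pF = 0 := hN.inr_fst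
  have hA : pA ≫ iA = 𝟙 M - pF ≫ iF := by rw [← hM.total]; abel
  have hjA : j ≫ pA = p ≫ k ≫ j ≫ pA := by
    have h₁ : p ≫ k = 𝟙 N - (j ≫ pF) ≫ f := by rw [← hN.total]; abel
    rw [← Category.assoc p, h₁]
    simp [Preadditive.sub_comp, reassoc_of% hf, hM.inr_fst]
  have hx : x ≫ b' ≫ pA = k ≫ j ≫ pA := by rw [reassoc_of% hb₁']
  have hxx : (k ≫ j ≫ pA) ≫ iA ≫ b = x := by
    have : k ≫ j ≫ (pA ≫ iA) ≫ b = k ≫ j ≫ b := by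
      rw [hA]
      simp [Preadditive.sub_comp, Preadditive.comp_sub, reassoc_of% hkF]
    simp only [Category.assoc] at this ⊢
    rw [this, hb₁, ← Category.assoc, hN.inr_snd, Category.id_comp]
  have hg : (iA ≫ b) ≫ y = g := by
    rw [Category.assoc, ← hb₂, reassoc_of% hM.inl_fst]
  have hy : (b' ≫ pA) ≫ g = y := by rw [Category.assoc, ← hb₂']
  have hiso : IsIso (b' ≫ pA) := by
    refine isIso_of_comp_isIso _ (iA ≫ b) ?_ ?_
    · refine isIso_of_seqClass_endo hL _ ?_ (by rw [Category.assoc, hg, hy])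
      rw [← Category.assoc, hx, hxx]
    -- Exactness of `K ⟶ A ⟶ X` is not yet known, so `t - 𝟙` is lifted through the given conflation
    -- on `M` instead.
    · refine isIso_of_sub_one_sq _ ?_
      set t := (iA ≫ b) ≫ b' ≫ pA with ht
      have htg : t ≫ g = g := by rw [ht, Category.assoc, hy, hg]
      have hkt : (k ≫ j ≫ pA) ≫ t = k ≫ j ≫ pA := by
        rw [ht, ← Category.assoc, hxx, hx]
      obtain ⟨v, hv⟩ := exists_lift_of_seqClass h ((t - 𝟙 A) ≫ iA) (by
        rw [Category.assoc, reassoc_of% hM.inl_fst, Preadditive.sub_comp, htg]; simp)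
      have hv' : t - 𝟙 A = v ≫ p ≫ k ≫ j ≫ pA := by
        rw [← hjA, reassoc_of% hv, hM.inl_fst, Category.comp_id]
      nth_rewrite 1 [hv']
      simp only [Category.assoc] at hkt
      simp [Preadditive.comp_sub, hkt]
  refine ⟨_, hL.trans (SeqClass.mk_eq_of_iso (asIso (b' ≫ pA)) hx hy)⟩

end Exactness

end Conflations

section Semibricks

variable {C : Type u} [Category.{v} C] [Preadditive C] {𝒳 : ObjectProperty C}

lemma IsBrick.isIso {X : C} (hX : IsBrick X) {f : X ⟶ X} (hf : f ≠ 0) : IsIso f :=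
  (isUnit_iff_isIso _).1 (hX.2 f hf)

lemma IsSemibrick.isIso (h𝒳 : IsSemibrick 𝒳) {X Y : C} (hX : 𝒳 X) (hY : 𝒳 Y) {f : X ⟶ Y}
    (hf : f ≠ 0) : IsIso f := by
  by_cases he : IsEmpty (X ≅ Y)
  · exact absurd (h𝒳.hom_eq_zero X Y hX hY he f) hf
  · obtain ⟨e⟩ := not_isEmpty_iff.1 he
    have : IsIso (f ≫ e.inv) := (h𝒳.brick X hX).isIso (fun h => hf (by
      simpa using congrArg (fun t => t ≫ e.hom) h))
    exact IsIso.of_isIso_comp_right f e.inv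

end Semibricks

/-! ### Filtrations: direct sums and deflations onto bricks -/

section Filtrations

variable {C : Type u} [Category.{v} C] [Preadditive C] [HasBinaryBiproducts C]
variable {T : Extriangulation.{w} C} {𝒳 : ObjectProperty C}

lemma HasFiltration.of_iso {n : ℕ} {M M' : C} (h : HasFiltration T 𝒳 n M) (e : M ≅ M') :
    HasFiltration T 𝒳 n M' := by
  cases h with
  | zero hM => exact .zero (hM.of_iso e.symm)
  | succ hN f g hfg hX => exact .succ hN _ _ (isConflation_comp_iso_mid hfg e) hX

variable [HasZeroObject C]

open ZeroObject

lemma HasFiltration.biprod {a b : ℕ} {A B : C} (hA : HasFiltration T 𝒳 a A)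
    (hB : HasFiltration T 𝒳 b B) : HasFiltration T 𝒳 (a + b) (A ⊞ B) := by
  induction hB with
  | zero hM =>
    refine hA.of_iso ⟨biprod.inl, biprod.fst, by simp, ?_⟩
    ext
    · simp
    · simp
    · exact hM.eq_of_src _ _
    · exact hM.eq_of_src _ _
  | @succ n N M X hN f g hfg hX ih =>
    obtain ⟨δ, hδ⟩ := hfg
    have h₁ := T.realization_sum ((isBiprod_id_left A (isZero_zero C)).seqClass_zero T) hδ
    have h₂ : IsConflation T _ _ := ⟨_, h₁⟩
    let e : (0 : C) ⊞ X ≅ X := ⟨biprod.snd, biprod.inr, by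
      rw [← biprod.total, (isZero_zero C).eq_of_tgt biprod.fst 0, zero_comp, zero_add],
      by simp⟩
    exact .succ ih _ _ (isConflation_comp_iso_right h₂ e) hX

/-- A nonzero morphism from a filtered object to a member of the semibrick is a deflation
whose cocone has a shorter filtration. -/
lemma HasFiltration.exists_cocone (h𝒳 : IsSemibrick 𝒳) {n : ℕ} {M : C}
    (hM : HasFiltration T 𝒳 n M) {X : C} (hX : 𝒳 X) (f : M ⟶ X) (hf : f ≠ 0) :
    ∃ (m : ℕ) (L : C) (j : L ⟶ M), n = m + 1 ∧ HasFiltration T 𝒳 m L ∧ IsConflation T j f := by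
  induction hM with
  | zero hM => exact absurd (hM.eq_of_src _ _) hf
  | @succ n N M X' hN i g hig hX' ih =>
    by_cases h0 : i ≫ f = 0
    · obtain ⟨δ, hδ⟩ := hig
      obtain ⟨h, rfl⟩ := exists_desc_of_seqClass hδ f h0
      have hh : h ≠ 0 := by rintro rfl; simp at hf
      have := h𝒳.isIso hX' hX hh
      exact ⟨n, N, i, rfl, hN, isConflation_comp_iso_right ⟨δ, hδ⟩ (asIso h)⟩
    -- By (ET4), `K ⟶ N ⟶ M` has a cone `G` that is an extension of `X'` by `X`. The map `t : G ⟶ X`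
    -- induced by `f` splits it, and the dual of (ET4) then makes the cocone of `f` an extension of
    -- `X'` by `K`.
    · obtain ⟨m, K, k, rfl, hK, δ, hδ⟩ := ih (i ≫ f) h0
      obtain ⟨δ', hδ'⟩ := hig
      obtain ⟨G, d, e, _, q, ε, rfl, hq, -, hε, hde, -, -⟩ := T.et4 hδ hδ'
      obtain ⟨t, ht⟩ := exists_desc_of_seqClass hε f (by
        rw [Category.assoc, comp_eq_zero_of_seqClass hδ])
      have hdt : d ≫ t = 𝟙 X := by
        -- Otherwise `d ≫ t - 𝟙 X` is an automorphism of the brick `X`; it kills `i ≫ f`, which is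
        -- nonzero.
        by_contra hne
        have := (h𝒳.brick X hX).isIso (sub_ne_zero.2 hne)
        have h1 : (i ≫ f) ≫ (d ≫ t - 𝟙 X) = 0 := by
          rw [Preadditive.comp_sub, ← Category.assoc, hq, Category.assoc, ht]
          simp
        exact h0 ((cancel_mono (d ≫ t - 𝟙 X)).1 (by rw [h1, zero_comp]))
      obtain ⟨u, hu⟩ := exists_section_of_retraction hde t hdt
      obtain ⟨L, d', e', j, _, ε', rfl, -, -, hj, hd', -, -⟩ :=
        T.et4_op hε (hu.symm.seqClass_zero T)
      rw [ht] at hj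
      exact ⟨m + 1, L, j, rfl, .succ hK d' e' ⟨_, hd'⟩ hX', ⟨_, hj⟩⟩

end Filtrations

/-! ### Filtrations of retracts -/

section Summands

variable {C : Type u} [Category.{v} C] [Preadditive C] [HasBinaryBiproducts C]
  [HasFiniteBiproducts C] {T : Extriangulation.{w} C} {𝒳 : ObjectProperty C}

lemma HasFiltration.exists_of_retract (hC : IsKrullSchmidt C)
    (h𝒳 : IsSemibrick 𝒳) {n : ℕ} :
    ∀ {M : C}, HasFiltration T 𝒳 n M → ∀ {A B : C} (sA : A ⟶ M) (rA : M ⟶ A) (sB : B ⟶ M)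
      (rB : M ⟶ B), sA ≫ rA = 𝟙 A → sB ≫ rB = 𝟙 B → sA ≫ rB = 0 → sB ≫ rA = 0 →
      ∃ a b : ℕ, HasFiltration T 𝒳 a A ∧ HasFiltration T 𝒳 b B ∧ a + b ≤ n := by
  induction n with
  | zero =>
    intro M hM A B sA rA sB rB hA hB _ _
    cases hM with
    | zero hM =>
      refine ⟨0, 0, .zero ?_, .zero ?_, le_rfl⟩
      · rw [IsZero.iff_id_eq_zero, ← hA, hM.eq_of_tgt sA 0, zero_comp]
      · rw [IsZero.iff_id_eq_zero, ← hB, hM.eq_of_tgt sB 0, zero_comp]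
  | succ n ih =>
    intro M hM A B sA rA sB rB hA hB hAB hBA
    have key : ∀ {A B X : C} (sA : A ⟶ M) (rA : M ⟶ A) (sB : B ⟶ M) (rB : M ⟶ B) (f : M ⟶ X),
        sA ≫ rA = 𝟙 A → sB ≫ rB = 𝟙 B → sA ≫ rB = 0 → sB ≫ rA = 0 → 𝒳 X → sA ≫ f ≠ 0 →
        ∃ a b : ℕ, HasFiltration T 𝒳 a A ∧ HasFiltration T 𝒳 b B ∧ a + b ≤ n + 1 := by
      intro A B X sA rA sB rB f hA hB hAB hBA hX hf
      obtain ⟨F, iF, pF, hF⟩ := exists_complement hC sA rA hA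
      obtain ⟨m, L, j, hm, hL, δ, hδ⟩ := hM.exists_cocone h𝒳 hX (rA ≫ sA ≫ f) (fun h => hf (by
        simpa [reassoc_of% hA] using congrArg (fun t => sA ≫ t) h))
      obtain rfl : n = m := by omega
      obtain ⟨l, hl⟩ := exists_lift_of_seqClass hδ iF (by rw [reassoc_of% hF.inr_fst, zero_comp])
      obtain ⟨K, k, p, hK⟩ := exists_complement hC l (j ≫ pF)
        (by rw [reassoc_of% hl, hF.inr_snd])
      have hc := exists_isConflation_of_isBiprod hF hδ hl hK
      -- `B` is a retract of `L` through the summand `F`, hence orthogonal to `K`.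
      obtain ⟨a, b, ha, hb, hab⟩ := ih hL k p (sB ≫ pF ≫ l) (j ≫ pF ≫ iF ≫ rB) hK.inr_snd (by
          have h₁ : pF ≫ iF = 𝟙 M - rA ≫ sA := by rw [← hF.total]; abel
          have h₂ : l ≫ j ≫ pF = 𝟙 F := hK.inl_fst
          have h₃ : sB ≫ (pF ≫ iF) ≫ rB = 𝟙 B := by
            rw [h₁]
            simp [Preadditive.sub_comp, hAB, hB]
          simpa only [Category.assoc, reassoc_of% h₂] using h₃)
        (by
          have h₁ : k ≫ j ≫ pF = 0 := hK.inr_fst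
          rw [reassoc_of% h₁, zero_comp])
        (by simp only [Category.assoc, hK.inl_snd, comp_zero])
      exact ⟨a + 1, b, .succ ha _ _ hc hX, hb, by omega⟩
    cases id hM with
    | succ hN i f hif hX =>
      by_cases hAf : sA ≫ f = 0
      · by_cases hBf : sB ≫ f = 0
        · obtain ⟨δ, hδ⟩ := hif
          obtain ⟨tA, rfl⟩ := exists_lift_of_seqClass hδ sA hAf
          obtain ⟨tB, rfl⟩ := exists_lift_of_seqClass hδ sB hBf
          simp only [Category.assoc] at hA hB hAB hBA
          obtain ⟨a, b, ha, hb, hab⟩ := ih hN tA (i ≫ rA) tB (i ≫ rB) hA hB hAB hBA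
          exact ⟨a, b, ha, hb, by omega⟩
        · obtain ⟨b, a, hb, ha, hab⟩ := key sB rB sA rA f hB hA hBA hAB hX hBf
          exact ⟨a, b, ha, hb, by omega⟩
      · exact key sA rA sB rB f hA hB hAB hBA hX hAf

lemma HasFiltration.exists_of_iso_biprod (hC : IsKrullSchmidt C)
    (h𝒳 : IsSemibrick 𝒳) {n : ℕ} {X A B : C} (hX : HasFiltration T 𝒳 n X) (e : X ≅ A ⊞ B) :
    ∃ a b : ℕ, HasFiltration T 𝒳 a A ∧ HasFiltration T 𝒳 b B ∧ a + b ≤ n :=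
  (hX.of_iso e).exists_of_retract hC h𝒳 biprod.inl biprod.fst biprod.inr biprod.snd
    (by simp) (by simp) (by simp) (by simp)

end Summands

end Extri

theorem mainTheorem5 {k : Type*} [Field k] {C : Type u} [Category.{v} C] [EssentiallySmall.{v} C]
    [Preadditive C] [Linear k C] [HasBinaryBiproducts C] [HasFiniteBiproducts C]
    (hHomFinite : ∀ X Y : C, Module.Finite k (X ⟶ Y))
    (hKrullSchmidt : Extri.IsKrullSchmidt C)
    (T : Extriangulation.{w} C) (𝒳 : ObjectProperty C) (h𝒳 : Extri.IsSemibrick 𝒳) :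
    (∀ X A B : C, Extri.Filt T 𝒳 X → Nonempty (X ≅ A ⊞ B) →
      Extri.Filt T 𝒳 A ∧ Extri.Filt T 𝒳 B) ∧
    (∀ X A B : C, Extri.Filt T 𝒳 X → Nonempty (X ≅ A ⊞ B) →
      Extri.length T 𝒳 X = Extri.length T 𝒳 A + Extri.length T 𝒳 B) := by
  refine ⟨?_, ?_⟩
  · rintro X A B ⟨n, hX⟩ ⟨e⟩
    obtain ⟨a, b, ha, hb, -⟩ := hX.exists_of_iso_biprod hKrullSchmidt h𝒳 e
    exact ⟨⟨a, ha⟩, ⟨b, hb⟩⟩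
  · rintro X A B hX ⟨e⟩
    have hX' : Extri.HasFiltration T 𝒳 (Extri.length T 𝒳 X) X := Nat.sInf_mem hX
    obtain ⟨a, b, ha, hb, hab⟩ := hX'.exists_of_iso_biprod hKrullSchmidt h𝒳 e
    have hA : Extri.HasFiltration T 𝒳 (Extri.length T 𝒳 A) A := Nat.sInf_mem (s := {n | Extri.HasFiltration T 𝒳 n A}) ⟨a, ha⟩
    have hB : Extri.HasFiltration T 𝒳 (Extri.length T 𝒳 B) B := Nat.sInf_mem (s := {n | Extri.HasFiltration T 𝒳 n B}) ⟨b, hb⟩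
    refine le_antisymm (Nat.sInf_le ((hA.biprod hB).of_iso e.symm)) ?_
    exact (Nat.add_le_add (Nat.sInf_le ha) (Nat.sInf_le hb)).trans hab
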